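/- Let $B(\theta)=\log\{(e^\theta-1)/\theta\}$ with $B(0)=0$, so that $B'$ maps $\mathbb{R}$ bijectively onto $(0,1)$. For an integer $\lambda\ge 1$ the cobin distribution with natural parameter $\theta$ and dispersion $\lambda^{-1}$ has density $p(y;\theta,\lambda^{-1})=h(y,\lambda)\exp[\lambda\{\theta y-B(\theta)\}]$, $0\le y\le 1$, where $h(y,1)=1$ and $h(y,\lambda)=\frac{\lambda}{(\lambda-1)!}\sum_{k=0}^{\lambda}(-1)^k\binom{\lambda}{k}\max(\lambda y-k,0)^{\lambda-1}$ for $\lambda\ge 2$; its support is $[0,1]$ if $\lambda=1$ and $(0,1)$ if $\lambda\ge2$. Let the link $g:(0,1)\to\mathbb{R}$ be strictly monotone, onto, and continuously differentiable with nonvanishing derivative. Write $\mu(\eta)=g^{-1}(\eta)$ and $\theta(\eta)=(B')^{-1}(g^{-1}(\eta))$. The cobin likelihood equations for observations $(x_i,y_i)\in\mathbb{R}^p\times[0,1]$, $i=1,\dots,n$, are $$\lambda\sum_{i=1}^n\frac{\{y_i-\mu(\eta_i)\}\,x_{ij}}{B''(\theta(\eta_i))}\,\mu'(\eta_i)=0,\qquad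 \eta_i=x_i^{\mathsf T}\beta,\quad j=1,\dots,p .$$ Let $(x_i,y_i)_{i\ge1}$ be independent random pairs in $\mathbb{R}^p\times[0,1]$ and let $\beta_0\in\mathbb{R}^p$ be such that $E(y_i\mid x_i)=g^{-1}(x_i^{\mathsf T}\beta_0)$ almost surely for every $i$; the distribution of $y_i$ given $x_i$ is otherwise arbitrary, and in particular need not be cobin. Assume the following regularity conditions. (R1) $\Theta\subset\mathbb{R}^p$ is compact and $\beta_0$ is an interior point of $\Theta$. (R2) There is a probability measure $\nu$ on $\mathbb{R}^p$ such that $\frac1n\sum_{i=1}^n E f(x_i)\to\int f\,d\nu$ for every bounded continuous $f$. (R3) There is a continuous $b$ on $\mathbb{R}^p$ with $\|x\|\,|\mu'(x^{\mathsf T}\beta)/B''(\theta(x^{\mathsf T}\beta))|\le b(x)$ for all $x\in\mathbb{R}^p$ and $\beta\in\Theta$, such that all $E\,b(x_i)$ and $\int b\,d\nu$ are finite and $\frac1n\sum_{i=1}^n E\,b(x_i)\to\int b\,d\nu$. (R4) If $\beta\in\Theta$ and $g^{-1}(x^{\mathsf T}\beta)=g^{-1}(x^{\mathsf T}\beta_0)$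 for $\nu$-almost every $x$, then $\beta=\beta_0$. (If the pairs are identically distributed, take for $\nu$ the law of $x_1$: then (R2) is automatic and (R3) only asks that $E\,b(x_1)<\infty$. Nonrandom $x_i$ are allowed.) Then the following hold. (i) If $y_1,\dots,y_n$ lie in the support of the cobin distribution, the left-hand side of the $j$-th likelihood equation is $\frac{\partial}{\partial\beta_j}\sum_{i=1}^n\log p(y_i;\theta(x_i^{\mathsf T}\beta),\lambda^{-1})$, for every $\beta\in\mathbb{R}^p$ and every $j$. (ii) With probability tending to one as $n\to\infty$, the likelihood equations have a solution in $\Theta$. (iii) Every sequence of estimators $\hat\beta_n$ that, with probability tending to one, lies in $\Theta$ and solves the likelihood equations is consistent: $\hat\beta_n\to\beta_0$ in probability. -/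

import Mathlib

open MeasureTheory ProbabilityTheory Filter Topology Set

noncomputable section

namespace Cobin

/-- Covariate and coefficient vectors. -/
abbrev Vec (p : ℕ) := EuclideanSpace ℝ (Fin p)

/-- The cumulant function `B(θ) = log {(e^θ - 1)/θ}`, with its limiting value `log 1` at `θ = 0`. -/
def B (θ : ℝ) : ℝ :=
  Real.log (if θ = 0 then 1 else (Real.exp θ - 1) / θ)

/-- The mean map `B'`. -/
def B' : ℝ → ℝ := deriv B

/-- The unit variance map `B''`. -/
def B'' : ℝ → ℝ := deriv B'

/-- The inverse `(B')⁻¹` of the mean map (`B'` is a bijection of `ℝ` onto `(0,1)`). -/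
def naturalParam (μ : ℝ) : ℝ := Function.invFun B' μ

/-- The carrier `h(y, l)` of the cobin density with dispersion parameter `1 / l`.  For `l = 1` the
truncated powers in the general formula have exponent `0`, and the carrier is the uniform density
on `[0,1]`. -/
def carrier (l : ℕ) (y : ℝ) : ℝ :=
  if l = 1 then (Icc (0 : ℝ) 1).indicator (fun _ => 1) y
  else (l : ℝ) / ((l - 1).factorial : ℝ) *
    ∑ k ∈ Finset.range (l + 1),
      (-1 : ℝ) ^ k * (l.choose k : ℝ) * (max ((l : ℝ) * y - (k : ℝ)) 0) ^ (l - 1)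

/-- The cobin density `p(y; θ, 1/l) = h(y, l) exp[l {θ y - B(θ)}]`. -/
def density (l : ℕ) (θ y : ℝ) : ℝ :=
  carrier l y * Real.exp ((l : ℝ) * (θ * y - B θ))

/-- The support of the cobin distribution with dispersion parameter `1 / l`. -/
def support (l : ℕ) : Set ℝ := if l = 1 then Icc 0 1 else Ioo 0 1

/-- `g : (0,1) → ℝ` is a link function: strictly monotone, continuously differentiable with
nonvanishing derivative, and onto `ℝ`, so that `g⁻¹` is defined at every linear predictor and the
derivative of `g⁻¹` exists everywhere and is continuous.  Values of `g` outside `(0,1)` play no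
role. -/
structure IsLink (g : ℝ → ℝ) : Prop where
  strictMono_or_strictAnti : StrictMonoOn g (Ioo 0 1) ∨ StrictAntiOn g (Ioo 0 1)
  contDiffOn : ContDiffOn ℝ 1 g (Ioo 0 1)
  deriv_ne_zero : ∀ μ ∈ Ioo (0 : ℝ) 1, deriv g μ ≠ 0
  surjOn : SurjOn g (Ioo 0 1) univ

/-- The inverse link `g⁻¹ : ℝ → (0,1)`, mapping a linear predictor `η` to a mean `μ`. -/
def invLink (g : ℝ → ℝ) (η : ℝ) : ℝ := Function.invFunOn g (Ioo 0 1) η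

/-- The natural parameter `θ = (B')⁻¹ (g⁻¹ η)` as a function of the linear predictor. -/
def thetaOf (g : ℝ → ℝ) (η : ℝ) : ℝ := naturalParam (invLink g η)

/-- The linear predictor `xᵀβ`. -/
def linPred {p : ℕ} (x β : Vec p) : ℝ := ∑ j, x j * β j

/-- The cobin regression log-likelihood of the first `n` observations. -/
def logLik {p : ℕ} (g : ℝ → ℝ) (l n : ℕ) (x : ℕ → Vec p) (y : ℕ → ℝ) (β : Vec p) : ℝ :=
  ∑ i ∈ Finset.range n, Real.log (density l (thetaOf g (linPred (x i) β)) (y i))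

/-- The score: `l ∑ᵢ (yᵢ - μᵢ) xᵢⱼ / B''(θᵢ) · ∂μᵢ/∂ηᵢ`, over the first `n` observations. -/
def score {p : ℕ} (g : ℝ → ℝ) (l n : ℕ) (x : ℕ → Vec p) (y : ℕ → ℝ) (β : Vec p)
    (j : Fin p) : ℝ :=
  (l : ℝ) * ∑ i ∈ Finset.range n,
    (y i - invLink g (linPred (x i) β)) * x i j / B'' (thetaOf g (linPred (x i) β)) *
      deriv (invLink g) (linPred (x i) β)

/-- `β` solves the cobin regression likelihood equations of the first `n` observations. -/
def SolvesLikelihoodEq {p : ℕ} (g : ℝ → ℝ) (l n : ℕ) (x : ℕ → Vec p) (y : ℕ → ℝ)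
    (β : Vec p) : Prop :=
  ∀ j, score g l n x y β j = 0

end Cobin

end

noncomputable section

namespace Cobin

/-! ### The cumulant function -/

/-- The uniform distribution on the unit interval. -/
abbrev uniformMeasure : Measure ℝ := volume.restrict (Icc (0 : ℝ) 1)

lemma integrable_exp_mul_uniform (θ : ℝ) :
    Integrable (fun x : ℝ => Real.exp (θ * id x)) uniformMeasure :=
  (Continuous.continuousOn (by fun_prop)).integrableOn_Icc

lemma mem_interior_integrableExpSet_uniform (θ : ℝ) :
    θ ∈ interior (integrableExpSet (id : ℝ → ℝ) uniformMeasure) := by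
  have : integrableExpSet (id : ℝ → ℝ) uniformMeasure = univ :=
    eq_univ_of_forall integrable_exp_mul_uniform
  simp [this]

lemma mgf_uniform (θ : ℝ) :
    mgf id uniformMeasure θ = if θ = 0 then 1 else (Real.exp θ - 1) / θ := by
  rw [mgf, integral_Icc_eq_integral_Ioc, ← intervalIntegral.integral_of_le zero_le_one]
  split_ifs with h
  · simp [h]
  · have := intervalIntegral.integral_comp_mul_left (a := 0) (b := 1) Real.exp h
    simp only [id] at *
    rw [this]
    simp [integral_exp]
    field_simp

lemma B_eq_cgf : B = cgf id uniformMeasure := by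
  ext θ
  rw [cgf, mgf_uniform, B]

lemma uniformMeasure_ne_zero : uniformMeasure ≠ 0 := by
  simp [Measure.restrict_eq_zero]

lemma analyticAt_B (θ : ℝ) : AnalyticAt ℝ B θ := by
  rw [B_eq_cgf]
  exact analyticAt_cgf (mem_interior_integrableExpSet_uniform θ)

lemma analyticAt_B' (θ : ℝ) : AnalyticAt ℝ B' θ := (analyticAt_B θ).deriv

lemma hasStrictDerivAt_B' (θ : ℝ) : HasStrictDerivAt B' (B'' θ) θ :=
  (analyticAt_B' θ).hasStrictDerivAt

lemma hasDerivAt_B (θ : ℝ) : HasDerivAt B (B' θ) θ :=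
  (analyticAt_B θ).differentiableAt.hasDerivAt

lemma continuous_B'' : Continuous B'' :=
  continuous_iff_continuousAt.2 fun θ => (analyticAt_B' θ).deriv.continuousAt

lemma B''_pos (θ : ℝ) : 0 < B'' θ := by
  have hθ := mem_interior_integrableExpSet_uniform θ
  have h2 : B'' θ = iteratedDeriv 2 (cgf id uniformMeasure) θ := by
    rw [← B_eq_cgf, iteratedDeriv_succ, iteratedDeriv_one]; rfl
  rw [h2, iteratedDeriv_two_cgf_eq_integral hθ]
  refine div_pos ?_ (mgf_pos' uniformMeasure_ne_zero (integrable_exp_mul_uniform θ))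
  set m := deriv (cgf id uniformMeasure) θ
  have hint : Integrable (fun x : ℝ => (id x - m) ^ 2 * Real.exp (θ * id x)) uniformMeasure :=
    (Continuous.continuousOn (by fun_prop)).integrableOn_Icc
  have hnn : 0 ≤ fun x : ℝ => (id x - m) ^ 2 * Real.exp (θ * id x) := fun x => by positivity
  refine lt_of_le_of_ne (integral_nonneg hnn) fun h0 => ?_
  have hae := (integral_eq_zero_iff_of_nonneg hnn hint).1 h0.symm
  have hne : ∀ᵐ x ∂uniformMeasure, x ≠ m :=
    ae_iff.2 (by simp)
  have : ∀ᵐ x ∂uniformMeasure, False := by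
    filter_upwards [hae, hne] with x hx hxm
    simp [sub_eq_zero, hxm] at hx
  rw [Filter.eventually_false_iff_eq_bot, ae_eq_bot] at this
  exact uniformMeasure_ne_zero this

lemma strictMono_B' : StrictMono B' :=
  strictMono_of_deriv_pos B''_pos

lemma B'_of_ne_zero {θ : ℝ} (hθ : θ ≠ 0) :
    B' θ = Real.exp θ / (Real.exp θ - 1) - 1 / θ := by
  have hexp : Real.exp θ - 1 ≠ 0 := by simpa [sub_eq_zero] using hθ
  have hB : B =ᶠ[𝓝 θ] fun t => Real.log ((Real.exp t - 1) / t) := by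
    filter_upwards [isOpen_ne.mem_nhds hθ] with t ht
    simp [B, show t ≠ 0 from ht]
  have hd : HasDerivAt (fun t => Real.log ((Real.exp t - 1) / t))
      ((Real.exp θ * θ - (Real.exp θ - 1) * 1) / θ ^ 2 / ((Real.exp θ - 1) / θ)) θ :=
    (((Real.hasDerivAt_exp θ).sub_const 1).div (hasDerivAt_id θ) hθ).log (div_ne_zero hexp hθ)
  rw [B', hB.deriv_eq, hd.deriv]
  field_simp

lemma tendsto_B'_atTop : Tendsto B' atTop (𝓝 1) := by
  have h1 : Tendsto (fun θ : ℝ => 1 / (1 - Real.exp (-θ)) - 1 / θ) atTop (𝓝 (1 / (1 - 0) - 0)) := by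
    refine Tendsto.sub (Tendsto.div tendsto_const_nhds (tendsto_const_nhds.sub ?_) (by norm_num)) ?_
    · exact Real.tendsto_exp_neg_atTop_nhds_zero
    · exact tendsto_const_nhds.div_atTop tendsto_id
  norm_num at h1
  refine h1.congr' ?_
  filter_upwards [eventually_gt_atTop 0] with θ hθ
  have hexp : 1 < Real.exp θ := by simpa using hθ
  rw [B'_of_ne_zero hθ.ne', Real.exp_neg]
  have : Real.exp θ - 1 ≠ 0 := by linarith
  field_simp

lemma tendsto_B'_atBot : Tendsto B' atBot (𝓝 0) := by
  have h1 : Tendsto (fun θ : ℝ => Real.exp θ / (Real.exp θ - 1) - 1 / θ) atBot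
      (𝓝 (0 / (0 - 1) - 0)) := by
    refine Tendsto.sub (Tendsto.div Real.tendsto_exp_atBot
      (Real.tendsto_exp_atBot.sub tendsto_const_nhds) (by norm_num)) ?_
    exact tendsto_const_nhds.div_atBot tendsto_id
  norm_num at h1
  refine h1.congr' ?_
  filter_upwards [eventually_lt_atBot 0] with θ hθ
  rw [B'_of_ne_zero hθ.ne]
  simp

lemma exists_B'_eq {μ : ℝ} (hμ : μ ∈ Ioo (0 : ℝ) 1) : ∃ θ, B' θ = μ := by
  obtain ⟨a, ha⟩ := (tendsto_B'_atBot.eventually (gt_mem_nhds hμ.1)).exists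
  obtain ⟨c, hc⟩ := (tendsto_B'_atTop.eventually (lt_mem_nhds hμ.2)).exists
  exact mem_range_of_exists_le_of_exists_ge
    (continuous_iff_continuousAt.2 fun θ => (analyticAt_B' θ).continuousAt) ⟨a, ha.le⟩ ⟨c, hc.le⟩

lemma B'_naturalParam {μ : ℝ} (hμ : μ ∈ Ioo (0 : ℝ) 1) : B' (naturalParam μ) = μ :=
  Function.invFun_eq (exists_B'_eq hμ)

lemma hasDerivAt_naturalParam {μ : ℝ} (hμ : μ ∈ Ioo (0 : ℝ) 1) :
    HasDerivAt naturalParam (B'' (naturalParam μ))⁻¹ μ := by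
  have h := (hasStrictDerivAt_B' (naturalParam μ)).to_local_left_inverse (B''_pos _).ne'
    (g := naturalParam) (.of_forall fun θ => Function.leftInverse_invFun strictMono_B'.injective θ)
  rw [B'_naturalParam hμ] at h
  exact h.hasDerivAt

/-! ### The inverse link -/

namespace IsLink

variable {g : ℝ → ℝ}

lemma injOn (hg : IsLink g) : InjOn g (Ioo 0 1) :=
  hg.strictMono_or_strictAnti.elim StrictMonoOn.injOn StrictAntiOn.injOn

lemma invLink_mem (hg : IsLink g) (η : ℝ) : invLink g η ∈ Ioo (0 : ℝ) 1 :=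
  Function.invFunOn_mem (hg.surjOn (mem_univ η))

lemma apply_invLink (hg : IsLink g) (η : ℝ) : g (invLink g η) = η :=
  Function.invFunOn_eq (hg.surjOn (mem_univ η))

lemma invLink_apply (hg : IsLink g) {μ : ℝ} (hμ : μ ∈ Ioo (0 : ℝ) 1) : invLink g (g μ) = μ :=
  hg.injOn (hg.invLink_mem _) hμ (hg.apply_invLink _)

lemma hasDerivAt_invLink (hg : IsLink g) (η : ℝ) :
    HasDerivAt (invLink g) (deriv g (invLink g η))⁻¹ η := by
  have hmem := hg.invLink_mem η
  have hnhds := isOpen_Ioo.mem_nhds hmem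
  have hs : HasStrictDerivAt g (deriv g (invLink g η)) (invLink g η) :=
    (hg.contDiffOn.contDiffAt hnhds).hasStrictDerivAt one_ne_zero
  have h := hs.to_local_left_inverse (hg.deriv_ne_zero _ hmem) (g := invLink g)
    (by filter_upwards [hnhds] with μ hμ using hg.invLink_apply hμ)
  rw [hg.apply_invLink] at h
  exact h.hasDerivAt

lemma continuous_invLink (hg : IsLink g) : Continuous (invLink g) :=
  continuous_iff_continuousAt.2 fun η => (hg.hasDerivAt_invLink η).continuousAt

lemma deriv_invLink (hg : IsLink g) : deriv (invLink g) = fun η => (deriv g (invLink g η))⁻¹ :=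
  funext fun η => (hg.hasDerivAt_invLink η).deriv

lemma deriv_invLink_ne_zero (hg : IsLink g) (η : ℝ) : deriv (invLink g) η ≠ 0 := by
  rw [hg.deriv_invLink]
  exact inv_ne_zero (hg.deriv_ne_zero _ (hg.invLink_mem η))

lemma continuous_deriv_invLink (hg : IsLink g) : Continuous (deriv (invLink g)) := by
  rw [hg.deriv_invLink]
  exact ((hg.contDiffOn.continuousOn_deriv_of_isOpen isOpen_Ioo le_rfl).comp_continuous
    hg.continuous_invLink hg.invLink_mem).inv₀ fun η => hg.deriv_ne_zero _ (hg.invLink_mem η)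

lemma B'_thetaOf (hg : IsLink g) (η : ℝ) : B' (thetaOf g η) = invLink g η :=
  B'_naturalParam (hg.invLink_mem η)

end IsLink

/-- The weight `μ'(η) / B''(θ(η))` with which a residual enters the score. -/
def weight (g : ℝ → ℝ) (η : ℝ) : ℝ := deriv (invLink g) η / B'' (thetaOf g η)

namespace IsLink

variable {g : ℝ → ℝ}

lemma hasDerivAt_thetaOf (hg : IsLink g) (η : ℝ) : HasDerivAt (thetaOf g) (weight g η) η := by
  have h := (hasDerivAt_naturalParam (hg.invLink_mem η)).comp η
    (hg.hasDerivAt_invLink η).differentiableAt.hasDerivAt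
  rwa [mul_comm, ← div_eq_mul_inv] at h

lemma continuous_thetaOf (hg : IsLink g) : Continuous (thetaOf g) :=
  continuous_iff_continuousAt.2 fun η => (hg.hasDerivAt_thetaOf η).continuousAt

lemma continuous_weight (hg : IsLink g) : Continuous (weight g) :=
  hg.continuous_deriv_invLink.div (continuous_B''.comp hg.continuous_thetaOf)
    fun _ => (B''_pos _).ne'

lemma strictMono_or_strictAnti_invLink (hg : IsLink g) :
    StrictMono (invLink g) ∨ StrictAnti (invLink g) := by
  refine hg.strictMono_or_strictAnti.imp (fun h a c hac => ?_) (fun h a c hac => ?_)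
  · rwa [← h.lt_iff_lt (hg.invLink_mem a) (hg.invLink_mem c), hg.apply_invLink, hg.apply_invLink]
  · rwa [← h.lt_iff_gt (hg.invLink_mem a) (hg.invLink_mem c), hg.apply_invLink, hg.apply_invLink]

/-- The weight has the sign of the slope of the inverse link. -/
lemma sub_mul_weight_mul_sub_neg (hg : IsLink g) {a c : ℝ} (hac : a ≠ c) :
    (invLink g a - invLink g c) * weight g c * (c - a) < 0 := by
  have hB := B''_pos (thetaOf g c)
  have hne := hg.deriv_invLink_ne_zero c
  rcases hg.strictMono_or_strictAnti_invLink with h | h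
  · have hw : 0 < weight g c := div_pos (h.monotone.deriv_nonneg.lt_of_ne' hne) hB
    rcases hac.lt_or_gt with hlt | hlt
    · exact mul_neg_of_neg_of_pos (mul_neg_of_neg_of_pos (sub_neg.2 (h hlt)) hw) (sub_pos.2 hlt)
    · exact mul_neg_of_pos_of_neg (mul_pos (sub_pos.2 (h hlt)) hw) (sub_neg.2 hlt)
  · have hw : weight g c < 0 := div_neg_of_neg_of_pos (h.antitone.deriv_nonpos.lt_of_ne hne) hB
    rcases hac.lt_or_gt with hlt | hlt
    · exact mul_neg_of_neg_of_pos (mul_neg_of_pos_of_neg (sub_pos.2 (h hlt)) hw) (sub_pos.2 hlt)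
    · exact mul_neg_of_pos_of_neg (mul_pos_of_neg_of_neg (sub_neg.2 (h hlt)) hw) (sub_neg.2 hlt)

end IsLink

/-! ### Positivity of the carrier -/

/-- The alternating sum of truncated powers in the Irwin–Hall density of `n` uniform variables. -/
def truncSum (n : ℕ) (u : ℝ) : ℝ :=
  ∑ k ∈ Finset.range (n + 1), (-1 : ℝ) ^ k * (n.choose k : ℝ) * max (u - k) 0 ^ (n - 1)

lemma truncSum_succ {n : ℕ} (hn : 2 ≤ n) (u : ℝ) :
    truncSum (n + 1) u = u * truncSum n u + (n + 1 - u) * truncSum n (u - 1) := by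
  have hpow (v : ℝ) : max v 0 ^ n = v * max v 0 ^ (n - 1) := by
    obtain ⟨m, rfl⟩ : ∃ m, n = m + 1 := ⟨n - 1, by omega⟩
    rcases le_total v 0 with h | h
    · have : m ≠ 0 := by omega
      simp [h, this]
    · simp [h, pow_succ, mul_comm]
  have h1 : truncSum n u = ∑ k ∈ Finset.range (n + 2),
      (-1 : ℝ) ^ k * (n.choose k : ℝ) * max (u - k) 0 ^ (n - 1) := by
    rw [Finset.sum_range_succ]; simp [truncSum]
  have h2 : truncSum n (u - 1) = -∑ k ∈ Finset.range (n + 2),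
      (-1 : ℝ) ^ k * ((n + 1).choose k - n.choose k : ℝ) * max (u - k) 0 ^ (n - 1) := by
    rw [Finset.sum_range_succ', truncSum]
    simp only [Nat.choose_zero_right, Nat.cast_one, sub_self, mul_zero, zero_mul, add_zero,
      Nat.choose_succ_succ, Nat.cast_add, ← Finset.sum_neg_distrib]
    refine Finset.sum_congr rfl fun k _ => ?_
    rw [show u - 1 - (k : ℝ) = u - (k + 1) by ring]
    ring
  rw [h1, h2, truncSum, mul_neg, Finset.mul_sum, Finset.mul_sum, ← sub_eq_add_neg,
    ← Finset.sum_sub_distrib]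
  refine Finset.sum_congr rfl fun k hk => ?_
  rw [Nat.add_sub_cancel, hpow]
  have hc : ((n + 1 : ℕ) : ℝ) * n.choose k = (n + 1).choose k * ((n + 1 : ℕ) - k : ℝ) := by
    have hk' : k ≤ n + 1 := by simpa [Nat.lt_succ_iff] using hk
    rw [← Nat.cast_sub hk']
    exact_mod_cast (mul_comm _ _).trans (Nat.choose_mul_succ_eq n k)
  push_cast at hc
  linear_combination -(-1 : ℝ) ^ k * max (u - k) 0 ^ (n - 1) * hc

lemma truncSum_two (u : ℝ) : truncSum 2 u = max u 0 - 2 * max (u - 1) 0 + max (u - 2) 0 := by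
  simp [truncSum, Finset.sum_range_succ]
  ring

lemma truncSum_spec {n : ℕ} (hn : 2 ≤ n) :
    (∀ u : ℝ, 0 < u → u < n → 0 < truncSum n u) ∧ ∀ u, u ≤ 0 ∨ (n : ℝ) ≤ u → truncSum n u = 0 := by
  induction n, hn using Nat.le_induction with
  | base =>
    simp only [truncSum_two]
    refine ⟨fun u h0 h2 => ?_, fun u hu => ?_⟩
    · push_cast at h2
      rw [max_eq_left h0.le, max_eq_right (by linarith : u - 2 ≤ 0)]
      rcases max_choice (u - 1) 0 with h | h <;> rw [h] <;> linarith
    · push_cast at hu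
      rcases hu with h | h
      · rw [max_eq_right h, max_eq_right (by linarith), max_eq_right (by linarith)]; ring
      · rw [max_eq_left (by linarith), max_eq_left (by linarith), max_eq_left (by linarith)]; ring
  | succ n hn ih =>
    obtain ⟨hpos, hzero⟩ := ih
    have hnn (u : ℝ) : 0 ≤ truncSum n u := by
      by_cases h : 0 < u ∧ u < n
      · exact (hpos u h.1 h.2).le
      · rw [not_and_or, not_lt, not_lt] at h
        exact (hzero u h).ge
    have hn' : (2 : ℝ) ≤ n := by exact_mod_cast hn
    simp only [truncSum_succ hn]
    push_cast
    refine ⟨fun u h0 h1 => ?_, fun u hu => ?_⟩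
    · rcases lt_or_ge u n with h | h
      · exact add_pos_of_pos_of_nonneg (mul_pos h0 (hpos u h0 h))
          (mul_nonneg (by linarith) (hnn _))
      · exact add_pos_of_nonneg_of_pos (mul_nonneg h0.le (hnn _))
          (mul_pos (by linarith) (hpos _ (by linarith) (by linarith)))
    · rcases hu with h | h
      · rw [hzero u (.inl h), hzero (u - 1) (.inl (by linarith))]; ring
      · rw [hzero u (.inr (by linarith)), hzero (u - 1) (.inr (by linarith))]; ring

lemma carrier_pos {l : ℕ} (hl : 1 ≤ l) {y : ℝ} (hy : y ∈ support l) : 0 < carrier l y := by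
  by_cases h1 : l = 1
  · simp only [support, h1, if_true] at hy
    simp [carrier, h1, indicator_of_mem hy]
  · simp only [support, h1, if_false] at hy
    have hl' : (0 : ℝ) < l := by exact_mod_cast hl
    have := (truncSum_spec (by omega : 2 ≤ l)).1 (l * y) (mul_pos hl' hy.1)
      (by nlinarith [hy.2])
    simp only [carrier, h1, if_false]
    exact mul_pos (by positivity) this

/-! ### The score as a gradient -/

section Score

variable {p : ℕ} {g : ℝ → ℝ}

lemma linPred_eq_inner (z β : Vec p) : linPred z β = inner ℝ z β := by
  simp [linPred, PiLp.inner_apply, mul_comm]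

/-- The part of the cobin log-likelihood that depends on the coefficients. -/
def potential (g : ℝ → ℝ) (l n : ℕ) (x : ℕ → Vec p) (y : ℕ → ℝ) (β : Vec p) : ℝ :=
  ∑ i ∈ Finset.range n,
    (l : ℝ) * (thetaOf g (linPred (x i) β) * y i - B (thetaOf g (linPred (x i) β)))

lemma score_eq_sum_weight (l n : ℕ) (x : ℕ → Vec p) (y : ℕ → ℝ) (β : Vec p) (j : Fin p) :
    score g l n x y β j = l * ∑ i ∈ Finset.range n,
      (y i - invLink g (linPred (x i) β)) * weight g (linPred (x i) β) * x i j := by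
  simp only [score, weight]
  congr 1
  exact Finset.sum_congr rfl fun i _ => by ring

/-- The derivative of the potential along a line. -/
lemma IsLink.hasDerivAt_potential (hg : IsLink g) (l n : ℕ) (x : ℕ → Vec p) (y : ℕ → ℝ)
    (β v : Vec p) :
    HasDerivAt (fun t : ℝ => potential g l n x y (β + t • v))
      (l * ∑ i ∈ Finset.range n,
        (y i - invLink g (linPred (x i) β)) * weight g (linPred (x i) β) * linPred (x i) v) 0 := by
  rw [Finset.mul_sum]
  refine HasDerivAt.fun_sum fun i _ => ?_
  set η : ℝ → ℝ := fun t => linPred (x i) (β + t • v)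
  have hη : HasDerivAt η (linPred (x i) v) 0 := by
    have : η = fun t => linPred (x i) β + t * linPred (x i) v := by
      ext t; simp [η, linPred_eq_inner, inner_add_right, inner_smul_right]
    rw [this]
    simpa using ((hasDerivAt_id (0 : ℝ)).mul_const (linPred (x i) v)).const_add (linPred (x i) β)
  have hη0 : η 0 = linPred (x i) β := by simp [η]
  have hθ : HasDerivAt (fun t => thetaOf g (η t))
      (weight g (linPred (x i) β) * linPred (x i) v) 0 := by
    have := (hg.hasDerivAt_thetaOf (η 0)).comp 0 hη
    rwa [hη0] at this
  have hB : HasDerivAt (fun t => B (thetaOf g (η t))) (invLink g (linPred (x i) β) *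
      (weight g (linPred (x i) β) * linPred (x i) v)) 0 := by
    have := (hasDerivAt_B (thetaOf g (η 0))).comp 0 hθ
    rwa [hη0, hg.B'_thetaOf] at this
  exact (((hθ.mul_const (y i)).sub hB).const_mul (l : ℝ)).congr_deriv (by ring)

lemma IsLink.hasDerivAt_potential_single (hg : IsLink g) (l n : ℕ) (x : ℕ → Vec p) (y : ℕ → ℝ)
    (β : Vec p) (j : Fin p) :
    HasDerivAt (fun t : ℝ => potential g l n x y (β + t • EuclideanSpace.single j 1))
      (score g l n x y β j) 0 := by
  rw [score_eq_sum_weight]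
  have h (z : Vec p) : linPred z (EuclideanSpace.single j 1) = z j := by simp [linPred]
  simpa only [h] using hg.hasDerivAt_potential l n x y β (EuclideanSpace.single j 1)

lemma logLik_eq_potential {l n : ℕ} (hl : 1 ≤ l) (x : ℕ → Vec p) {y : ℕ → ℝ}
    (hy : ∀ i ∈ Finset.range n, y i ∈ support l) (β : Vec p) :
    logLik g l n x y β =
      ∑ i ∈ Finset.range n, Real.log (carrier l (y i)) + potential g l n x y β := by
  rw [logLik, potential, ← Finset.sum_add_distrib]
  refine Finset.sum_congr rfl fun i hi => ?_
  rw [density, Real.log_mul (carrier_pos hl (hy i hi)).ne' (Real.exp_ne_zero _), Real.log_exp]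

lemma IsLink.hasDerivAt_logLik (hg : IsLink g) {l n : ℕ} (hl : 1 ≤ l) (x : ℕ → Vec p) {y : ℕ → ℝ}
    (hy : ∀ i ∈ Finset.range n, y i ∈ support l) (β : Vec p) (j : Fin p) :
    HasDerivAt (fun t : ℝ => logLik g l n x y (β + t • EuclideanSpace.single j 1))
      (score g l n x y β j) 0 := by
  simp only [logLik_eq_potential hl x hy]
  exact (hg.hasDerivAt_potential_single l n x y β j).const_add _

lemma continuous_linPred : Continuous fun q : Vec p × Vec p => linPred q.1 q.2 := by
  simp only [linPred_eq_inner]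
  fun_prop

lemma IsLink.continuous_potential (hg : IsLink g) (l n : ℕ) (x : ℕ → Vec p) (y : ℕ → ℝ) :
    Continuous (potential g l n x y) := by
  have hB : Continuous B := continuous_iff_continuousAt.2 fun θ => (analyticAt_B θ).continuousAt
  refine continuous_finsetSum _ fun i _ => ?_
  have hθ : Continuous fun β => thetaOf g (linPred (x i) β) :=
    hg.continuous_thetaOf.comp (continuous_linPred.comp (by fun_prop : Continuous fun β => (x i, β)))
  exact ((hθ.mul_const (y i)).sub (hB.comp hθ)).const_mul _

end Score

/-! ### A weak law of large numbers under a convergent envelope -/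

section WeakLaw

variable {Ω E F : Type*} [MeasurableSpace Ω] {P : Measure Ω} [NormedAddCommGroup E]

/-- A continuous cutoff, `0` on the ball of radius `M` and `1` off the ball of radius `M + 1`. -/
def tailCutoff (M : ℕ) (z : E) : ℝ := max 0 (min 1 (‖z‖ - M))

lemma continuous_tailCutoff (M : ℕ) : Continuous (tailCutoff (E := E) M) := by
  unfold tailCutoff
  fun_prop

lemma tailCutoff_nonneg (M : ℕ) (z : E) : 0 ≤ tailCutoff M z := le_max_left _ _

lemma tailCutoff_le_one (M : ℕ) (z : E) : tailCutoff M z ≤ 1 :=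
  max_le zero_le_one (min_le_left _ _)

lemma tailCutoff_of_norm_le {M : ℕ} {z : E} (h : ‖z‖ ≤ M) : tailCutoff M z = 0 :=
  max_eq_left ((min_le_right _ _).trans (by linarith))

lemma tailCutoff_of_le_norm {M : ℕ} {z : E} (h : M + 1 ≤ ‖z‖) : tailCutoff M z = 1 := by
  rw [tailCutoff, min_eq_left (by linarith), max_eq_right zero_le_one]

/-- A continuous function is bounded where the cutoff differs from one. -/
lemma exists_abs_mul_one_sub_tailCutoff_le [ProperSpace E] {f : E → ℝ} (hf : Continuous f)
    (M : ℕ) : ∃ K, 0 ≤ K ∧ ∀ z, |f z| * (1 - tailCutoff M z) ≤ K := by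
  obtain ⟨K, hK⟩ := (isCompact_closedBall (0 : E) (M + 1)).exists_bound_of_continuousOn
    hf.continuousOn
  refine ⟨max K 0, le_max_right _ _, fun z => ?_⟩
  have h0 := tailCutoff_nonneg M z
  rcases le_total ‖z‖ (M + 1) with h | h
  · have : |f z| ≤ K := hK z (by simpa using h)
    exact (mul_le_of_le_one_right (abs_nonneg _) (by linarith)).trans (this.trans (le_max_left _ _))
  · rw [tailCutoff_of_le_norm h]
    simp

lemma abs_truncated_le {f b : E → ℝ} {C : ℝ} (hC : ∀ z, |f z| ≤ C * b z) (M : ℕ) (z : E) :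
    |f z * (1 - tailCutoff M z)| ≤ C * b z := by
  rw [abs_mul, abs_of_nonneg (sub_nonneg.2 (tailCutoff_le_one M z))]
  exact (mul_le_of_le_one_right (abs_nonneg _) (by linarith [tailCutoff_nonneg M z])).trans (hC z)

lemma continuous_truncated {f : E → ℝ} (hf : Continuous f) (M : ℕ) :
    Continuous fun z => f z * (1 - tailCutoff M z) :=
  hf.mul (continuous_const.sub (continuous_tailCutoff M))

variable [MeasurableSpace E]

/-- The expectation of `f (x i)`, averaged over the first `n` indices. -/
def average (P : Measure Ω) (x : ℕ → Ω → E) (n : ℕ) (f : E → ℝ) : ℝ :=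
  (n : ℝ)⁻¹ * ∑ i ∈ Finset.range n, ∫ ω, f (x i ω) ∂P

/-- The averaged laws of the `x i` converge weakly to `ν`, and the averages of the continuous
envelope `b` converge along with them. -/
structure ConvergesWithEnvelope (P : Measure Ω) (x : ℕ → Ω → E) (ν : Measure E) (b : E → ℝ) :
    Prop where
  measurable : ∀ i, Measurable (x i)
  weak : ∀ f : BoundedContinuousFunction E ℝ,
    Tendsto (fun n => average P x n f) atTop (𝓝 (∫ z, f z ∂ν))
  continuous : Continuous b
  nonneg : ∀ z, 0 ≤ b z
  integrable : Integrable b ν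
  integrable_comp : ∀ i, Integrable (fun ω => b (x i ω)) P
  tendsto : Tendsto (fun n => average P x n b) atTop (𝓝 (∫ z, b z ∂ν))

namespace ConvergesWithEnvelope

variable {x : ℕ → Ω → E} {ν : Measure E} {b : E → ℝ}

lemma abs_tail_le (H : ConvergesWithEnvelope P x ν b) (M : ℕ) (z : E) :
    |b z * tailCutoff M z| ≤ 1 * b z := by
  rw [abs_of_nonneg (mul_nonneg (H.nonneg z) (tailCutoff_nonneg M z)), one_mul]
  exact mul_le_of_le_one_right (H.nonneg z) (tailCutoff_le_one M z)

lemma continuous_tail (H : ConvergesWithEnvelope P x ν b) (M : ℕ) :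
    Continuous fun z => b z * tailCutoff M z :=
  H.continuous.mul (continuous_tailCutoff M)

/-- Truncated functions are covered by weak convergence. -/
lemma tendsto_average_truncated [ProperSpace E] (H : ConvergesWithEnvelope P x ν b)
    {f : E → ℝ} (hf : Continuous f) (M : ℕ) :
    Tendsto (fun n => average P x n fun z => f z * (1 - tailCutoff M z)) atTop
      (𝓝 (∫ z, f z * (1 - tailCutoff M z) ∂ν)) := by
  obtain ⟨K, -, hK⟩ := exists_abs_mul_one_sub_tailCutoff_le hf M
  refine H.weak (.ofNormedAddCommGroup (fun z => f z * (1 - tailCutoff M z))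
    (hf.mul (continuous_const.sub (continuous_tailCutoff M))) K fun z => ?_)
  rw [Real.norm_eq_abs, abs_mul, abs_of_nonneg (sub_nonneg.2 (tailCutoff_le_one M z))]
  exact hK z

variable [BorelSpace E]

lemma integrable_comp_of_le (H : ConvergesWithEnvelope P x ν b) {f : E → ℝ} (hf : Continuous f)
    {C : ℝ} (hC : ∀ z, |f z| ≤ C * b z) (i : ℕ) : Integrable (fun ω => f (x i ω)) P :=
  ((H.integrable_comp i).const_mul C).mono'
    (hf.measurable.comp (H.measurable i)).aestronglyMeasurable (.of_forall fun ω => hC (x i ω))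

lemma integrable_of_le (H : ConvergesWithEnvelope P x ν b) {f : E → ℝ} (hf : Continuous f)
    {C : ℝ} (hC : ∀ z, |f z| ≤ C * b z) : Integrable f ν :=
  (H.integrable.const_mul C).mono' hf.measurable.aestronglyMeasurable (.of_forall hC)

lemma tendsto_integral_tail (H : ConvergesWithEnvelope P x ν b) :
    Tendsto (fun M => ∫ z, b z * tailCutoff M z ∂ν) atTop (𝓝 0) := by
  have h : Tendsto (fun M => ∫ z, b z * tailCutoff M z ∂ν) atTop (𝓝 (∫ _, (0 : ℝ) ∂ν)) := by
    refine tendsto_integral_of_dominated_convergence b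
      (fun M => (H.continuous_tail M).measurable.aestronglyMeasurable) H.integrable
      (fun M => .of_forall fun z => (H.abs_tail_le M z).trans_eq (one_mul _))
      (.of_forall fun z => ?_)
    obtain ⟨N, hN⟩ := exists_nat_ge ‖z‖
    refine tendsto_const_nhds.congr' ?_
    filter_upwards [eventually_ge_atTop N] with M hM
    rw [tailCutoff_of_norm_le (hN.trans (by exact_mod_cast hM)), mul_zero]
  simpa using h

lemma average_add (H : ConvergesWithEnvelope P x ν b) {f f' : E → ℝ} (hf : Continuous f)
    (hf' : Continuous f') {C C' : ℝ} (hC : ∀ z, |f z| ≤ C * b z) (hC' : ∀ z, |f' z| ≤ C' * b z)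
    (n : ℕ) : average P x n (fun z => f z + f' z) = average P x n f + average P x n f' := by
  simp only [average, ← mul_add, ← Finset.sum_add_distrib]
  congr 1
  exact Finset.sum_congr rfl fun i _ =>
    integral_add (H.integrable_comp_of_le hf hC i) (H.integrable_comp_of_le hf' hC' i)

lemma abs_average_tail_le (H : ConvergesWithEnvelope P x ν b) {f : E → ℝ} {C : ℝ}
    (hC : ∀ z, |f z| ≤ C * b z) (M n : ℕ) :
    |average P x n fun z => f z * tailCutoff M z| ≤
      C * average P x n fun z => b z * tailCutoff M z := by
  rw [average, average, abs_mul, abs_of_nonneg (by positivity : (0 : ℝ) ≤ (n : ℝ)⁻¹),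
    mul_left_comm C, Finset.mul_sum]
  refine mul_le_mul_of_nonneg_left ((Finset.abs_sum_le_sum_abs _ _).trans
    (Finset.sum_le_sum fun i _ => ?_)) (by positivity)
  rw [← integral_const_mul]
  refine norm_integral_le_of_norm_le (f := fun ω => f (x i ω) * tailCutoff M (x i ω))
    ((H.integrable_comp_of_le (H.continuous_tail M) (H.abs_tail_le M) i).const_mul C)
    (.of_forall fun ω => ?_)
  rw [Real.norm_eq_abs, abs_mul, abs_of_nonneg (tailCutoff_nonneg M _), ← mul_assoc]
  exact mul_le_mul_of_nonneg_right (hC _) (tailCutoff_nonneg M _)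

variable [ProperSpace E]

lemma tendsto_average_tail (H : ConvergesWithEnvelope P x ν b) (M : ℕ) :
    Tendsto (fun n => average P x n fun z => b z * tailCutoff M z) atTop
      (𝓝 (∫ z, b z * tailCutoff M z ∂ν)) := by
  have hb (z : E) : |b z| ≤ 1 * b z := by rw [abs_of_nonneg (H.nonneg z), one_mul]
  have hc := continuous_truncated H.continuous M
  have hsplit : b = fun z => b z * tailCutoff M z + b z * (1 - tailCutoff M z) := by
    ext z; ring
  have hν : ∫ z, b z ∂ν =
      ∫ z, b z * tailCutoff M z ∂ν + ∫ z, b z * (1 - tailCutoff M z) ∂ν := by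
    rw [← integral_add (H.integrable_of_le (H.continuous_tail M) (H.abs_tail_le M))
      (H.integrable_of_le hc (abs_truncated_le hb M)), ← hsplit]
  have hn (n : ℕ) : average P x n b = average P x n (fun z => b z * tailCutoff M z) +
      average P x n (fun z => b z * (1 - tailCutoff M z)) := by
    rw [← H.average_add (H.continuous_tail M) hc (H.abs_tail_le M) (abs_truncated_le hb M),
      ← hsplit]
  have := H.tendsto.sub (H.tendsto_average_truncated H.continuous M)
  simpa only [hn, hν, add_sub_cancel_right] using this

/-- Averages of continuous functions dominated by the envelope converge. -/
lemma tendsto_average (H : ConvergesWithEnvelope P x ν b) {f : E → ℝ} (hf : Continuous f)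
    {C : ℝ} (hC : ∀ z, |f z| ≤ C * b z) :
    Tendsto (fun n => average P x n f) atTop (𝓝 (∫ z, f z ∂ν)) := by
  rw [Metric.tendsto_atTop']
  intro ε hε
  have htail : Tendsto (fun M => C * ∫ z, b z * tailCutoff M z ∂ν) atTop (𝓝 (C * 0)) :=
    H.tendsto_integral_tail.const_mul C
  rw [mul_zero] at htail
  obtain ⟨M, hM⟩ := (htail.eventually (gt_mem_nhds (by positivity : 0 < ε / 4))).exists
  have hct := continuous_truncated hf M
  have hcv : Continuous fun z => f z * tailCutoff M z := hf.mul (continuous_tailCutoff M)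
  have hv (z : E) : |f z * tailCutoff M z| ≤ C * b z := by
    rw [abs_mul, abs_of_nonneg (tailCutoff_nonneg M z)]
    exact (mul_le_of_le_one_right (abs_nonneg _) (tailCutoff_le_one M z)).trans (hC z)
  have hsplit : f = fun z => f z * tailCutoff M z + f z * (1 - tailCutoff M z) := by
    ext z; ring
  have hν : ∫ z, f z ∂ν =
      ∫ z, f z * tailCutoff M z ∂ν + ∫ z, f z * (1 - tailCutoff M z) ∂ν := by
    rw [← integral_add (H.integrable_of_le hcv hv)
      (H.integrable_of_le hct (abs_truncated_le hC M)), ← hsplit]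
  have hn (n : ℕ) : average P x n f = average P x n (fun z => f z * tailCutoff M z) +
      average P x n (fun z => f z * (1 - tailCutoff M z)) := by
    rw [← H.average_add hcv hct hv (abs_truncated_le hC M), ← hsplit]
  have hνtail : |∫ z, f z * tailCutoff M z ∂ν| ≤ C * ∫ z, b z * tailCutoff M z ∂ν := by
    rw [← integral_const_mul]
    refine norm_integral_le_of_norm_le (f := fun z => f z * tailCutoff M z)
      ((H.integrable_of_le (H.continuous_tail M) (H.abs_tail_le M)).const_mul C)
      (.of_forall fun z => ?_)
    rw [Real.norm_eq_abs, abs_mul, abs_of_nonneg (tailCutoff_nonneg M _), ← mul_assoc]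
    exact mul_le_mul_of_nonneg_right (hC _) (tailCutoff_nonneg M _)
  have h1 := ((H.tendsto_average_tail M).const_mul C).eventually (gt_mem_nhds hM)
  have h2 := (H.tendsto_average_truncated hf M).eventually
    (Metric.ball_mem_nhds _ (by positivity : 0 < ε / 4))
  obtain ⟨N, hN⟩ := eventually_atTop.1 (h1.and h2)
  refine ⟨N, fun n hNn => ?_⟩
  obtain ⟨h1, h2⟩ := hN n hNn.le
  have h3 := H.abs_average_tail_le hC M n
  obtain ⟨h2l, h2u⟩ := abs_lt.1 ((Real.dist_eq _ _).symm.trans_lt h2)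
  rw [Real.dist_eq, hn, hν, abs_lt]
  obtain ⟨h3l, h3u⟩ := abs_le.1 h3
  obtain ⟨h4l, h4u⟩ := abs_le.1 hνtail
  constructor <;> linarith

end ConvergesWithEnvelope

lemma variance_average_le [IsProbabilityMeasure P] {U : ℕ → Ω → ℝ} (hU : ∀ i, Measurable (U i))
    (hindep : iIndepFun U P) {K : ℝ} (hK : ∀ i, ∀ᵐ ω ∂P, |U i ω| ≤ K) (n : ℕ) :
    MemLp (fun ω => (n : ℝ)⁻¹ * ∑ i ∈ Finset.range n, U i ω) 2 P ∧
      variance (fun ω => (n : ℝ)⁻¹ * ∑ i ∈ Finset.range n, U i ω) P ≤ K ^ 2 * (n : ℝ)⁻¹ := by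
  have hL (i : ℕ) : MemLp (U i) 2 P := MemLp.of_bound (hU i).aestronglyMeasurable K (hK i)
  refine ⟨(memLp_finsetSum _ fun i _ => hL i).const_mul _, ?_⟩
  have hsum : variance (fun ω => ∑ i ∈ Finset.range n, U i ω) P ≤ n * K ^ 2 := by
    have : (fun ω => ∑ i ∈ Finset.range n, U i ω) = ∑ i ∈ Finset.range n, U i := by
      ext ω; simp
    rw [this, IndepFun.variance_sum (fun i _ => hL i) fun i _ j _ hij => hindep.indepFun hij]
    refine (Finset.sum_le_card_nsmul _ _ (K ^ 2) fun i _ => ?_).trans_eq (by simp)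
    have := variance_le_sq_of_bounded (a := -K) (b := K)
      ((hK i).mono fun ω h => abs_le.1 h) (hU i).aemeasurable
    convert! this using 2
    ring
  rw [variance_const_mul]
  rcases eq_or_ne n 0 with rfl | hn
  · simp
  · have hn' : (n : ℝ) ≠ 0 := by exact_mod_cast hn
    calc (n : ℝ)⁻¹ ^ 2 * variance (fun ω => ∑ i ∈ Finset.range n, U i ω) P
        ≤ (n : ℝ)⁻¹ ^ 2 * (n * K ^ 2) := mul_le_mul_of_nonneg_left hsum (by positivity)
      _ = K ^ 2 * (n : ℝ)⁻¹ := by field_simp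

/-- A weak law of large numbers, in one-sided form, for independent variables dominated by the
envelope. -/
theorem ConvergesWithEnvelope.weak_law [IsProbabilityMeasure P] [BorelSpace E] [ProperSpace E]
    [MeasurableSpace F] {x : ℕ → Ω → E} {ν : Measure E} {b : E → ℝ}
    (H : ConvergesWithEnvelope P x ν b) {y : ℕ → Ω → F} (hy : ∀ i, Measurable (y i))
    (hindep : iIndepFun (fun i ω => (x i ω, y i ω)) P) {h : E × F → ℝ} (hh : Measurable h)
    {C : ℝ} (hC0 : 0 ≤ C) (hC : ∀ i, ∀ᵐ ω ∂P, |h (x i ω, y i ω)| ≤ C * b (x i ω)) {m a : ℝ}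
    (hm : Tendsto (fun n : ℕ => (n : ℝ)⁻¹ * ∑ i ∈ Finset.range n, ∫ ω, h (x i ω, y i ω) ∂P)
      atTop (𝓝 m)) (ha : m < a) :
    Tendsto (fun n : ℕ => P {ω | a ≤ (n : ℝ)⁻¹ * ∑ i ∈ Finset.range n, h (x i ω, y i ω)})
      atTop (𝓝 0) := by
  rw [← ENNReal.tendsto_toReal_iff (fun _ => measure_ne_top _ _) ENNReal.zero_ne_top,
    ENNReal.toReal_zero, Metric.tendsto_atTop']
  intro ε hε
  set d := (a - m) / 4 with hd
  have hd0 : 0 < d := by linarith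
  have htail : Tendsto (fun M => C * ∫ z, b z * tailCutoff M z ∂ν) atTop (𝓝 (C * 0)) :=
    H.tendsto_integral_tail.const_mul C
  rw [mul_zero] at htail
  obtain ⟨M, hM1, hM2⟩ := ((htail.eventually (gt_mem_nhds (by positivity : 0 < d * (ε / 2)))).and
    (htail.eventually (gt_mem_nhds hd0))).exists
  obtain ⟨K, hK0, hK⟩ := exists_abs_mul_one_sub_tailCutoff_le H.continuous M
  set U : ℕ → Ω → ℝ := fun i ω => h (x i ω, y i ω) * (1 - tailCutoff M (x i ω)) with hUdef
  set V : ℕ → Ω → ℝ := fun i ω => h (x i ω, y i ω) * tailCutoff M (x i ω) with hVdef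
  set T : ℕ → Ω → ℝ := fun i ω => b (x i ω) * tailCutoff M (x i ω) with hTdef
  have hxy (i : ℕ) : Measurable fun ω => (x i ω, y i ω) := (H.measurable i).prodMk (hy i)
  have hψ : Measurable fun q : E × F => h q * (1 - tailCutoff M q.1) :=
    hh.mul (measurable_const.sub ((continuous_tailCutoff M).measurable.comp measurable_fst))
  have hUm (i : ℕ) : Measurable (U i) := hψ.comp (hxy i)
  have hVm (i : ℕ) : Measurable (V i) :=
    (hh.comp (hxy i)).mul ((continuous_tailCutoff M).measurable.comp (H.measurable i))
  have hUind : iIndepFun U P := hindep.comp (fun _ q => h q * (1 - tailCutoff M q.1)) fun _ => hψ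
  have hUK (i : ℕ) : ∀ᵐ ω ∂P, |U i ω| ≤ C * K := by
    filter_upwards [hC i] with ω hω
    have h1 : 0 ≤ 1 - tailCutoff M (x i ω) := sub_nonneg.2 (tailCutoff_le_one M _)
    rw [hUdef, abs_mul, abs_of_nonneg h1]
    calc |h (x i ω, y i ω)| * (1 - tailCutoff M (x i ω))
        ≤ C * b (x i ω) * (1 - tailCutoff M (x i ω)) := mul_le_mul_of_nonneg_right hω h1
      _ = C * (|b (x i ω)| * (1 - tailCutoff M (x i ω))) := by
          rw [abs_of_nonneg (H.nonneg _)]; ring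
      _ ≤ C * K := mul_le_mul_of_nonneg_left (hK _) hC0
  have hTi (i : ℕ) : Integrable (T i) P :=
    H.integrable_comp_of_le (H.continuous_tail M) (H.abs_tail_le M) i
  have hT0 (i : ℕ) (ω : Ω) : 0 ≤ T i ω := mul_nonneg (H.nonneg _) (tailCutoff_nonneg M _)
  have hVT (i : ℕ) : ∀ᵐ ω ∂P, |V i ω| ≤ C * T i ω := by
    filter_upwards [hC i] with ω hω
    rw [hVdef, abs_mul, abs_of_nonneg (tailCutoff_nonneg M _), hTdef, ← mul_assoc]
    exact mul_le_mul_of_nonneg_right hω (tailCutoff_nonneg M _)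
  have hUi (i : ℕ) : Integrable (U i) P :=
    (integrable_const (C * K)).mono' (hUm i).aestronglyMeasurable (hUK i)
  have hVi (i : ℕ) : Integrable (V i) P :=
    ((hTi i).const_mul C).mono' (hVm i).aestronglyMeasurable (hVT i)
  have hadd (i : ℕ) (ω : Ω) : h (x i ω, y i ω) = U i ω + V i ω := by
    simp only [hUdef, hVdef]; ring
  have hlim := ((H.tendsto_average_tail M).const_mul C)
  have hinv : Tendsto (fun n : ℕ => (C * K) ^ 2 * (n : ℝ)⁻¹ / d ^ 2) atTop (𝓝 0) := by
    simpa using (tendsto_inv_atTop_nhds_zero_nat (𝕜 := ℝ)).const_mul ((C * K) ^ 2)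
      |>.div_const (d ^ 2)
  obtain ⟨N, hN⟩ := eventually_atTop.1 ((hlim.eventually (gt_mem_nhds hM1)).and
    ((hlim.eventually (gt_mem_nhds hM2)).and ((hm.eventually (gt_mem_nhds
      (by linarith : m < m + d))).and (hinv.eventually (gt_mem_nhds (half_pos hε))))))
  refine ⟨N, fun n hNn => ?_⟩
  obtain ⟨hn1, hn2, hn3, hn4⟩ := hN n hNn.le
  rw [Real.dist_eq, sub_zero, abs_of_nonneg ENNReal.toReal_nonneg]
  set Ubar : Ω → ℝ := fun ω => (n : ℝ)⁻¹ * ∑ i ∈ Finset.range n, U i ω with hUbar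
  set Tbar : Ω → ℝ := fun ω => C * ((n : ℝ)⁻¹ * ∑ i ∈ Finset.range n, T i ω) with hTbar
  have hninv : (0 : ℝ) ≤ (n : ℝ)⁻¹ := by positivity
  have hTbarInt : ∫ ω, Tbar ω ∂P = C * average P x n fun z => b z * tailCutoff M z := by
    rw [hTbar, integral_const_mul, integral_const_mul, integral_finsetSum _ fun i _ => hTi i]
    rfl
  have hUbarInt : ∫ ω, Ubar ω ∂P < m + 2 * d := by
    have h1 : ∫ ω, Ubar ω ∂P = (n : ℝ)⁻¹ * ∑ i ∈ Finset.range n, ∫ ω, h (x i ω, y i ω) ∂P -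
        (n : ℝ)⁻¹ * ∑ i ∈ Finset.range n, ∫ ω, V i ω ∂P := by
      rw [hUbar, integral_const_mul, integral_finsetSum _ fun i _ => hUi i, ← mul_sub,
        ← Finset.sum_sub_distrib]
      congr 1
      refine Finset.sum_congr rfl fun i _ => ?_
      simp only [hadd]
      rw [integral_add (hUi i) (hVi i)]
      ring
    have h2 : -((n : ℝ)⁻¹ * ∑ i ∈ Finset.range n, ∫ ω, V i ω ∂P) ≤
        C * average P x n fun z => b z * tailCutoff M z := by
      rw [average, mul_left_comm C, ← mul_neg, Finset.mul_sum, ← Finset.sum_neg_distrib]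
      refine mul_le_mul_of_nonneg_left (Finset.sum_le_sum fun i _ => ?_) hninv
      refine (neg_le_abs _).trans ?_
      rw [← integral_const_mul]
      exact norm_integral_le_of_norm_le (f := V i) ((hTi i).const_mul C) (hVT i)
    rw [h1]
    linarith
  have hsub : {ω | a ≤ (n : ℝ)⁻¹ * ∑ i ∈ Finset.range n, h (x i ω, y i ω)} ≤ᵐ[P]
      ({ω | d ≤ |Ubar ω - ∫ ω, Ubar ω ∂P|} ∪ {ω | d ≤ Tbar ω} : Set Ω) := by
    filter_upwards [ae_all_iff.2 hVT] with ω hω hmem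
    by_contra hcon
    replace hmem : a ≤ (n : ℝ)⁻¹ * ∑ i ∈ Finset.range n, h (x i ω, y i ω) := hmem
    replace hcon : ¬(d ≤ |Ubar ω - ∫ ω, Ubar ω ∂P| ∨ d ≤ Tbar ω) := hcon
    rw [not_or, not_le, not_le, abs_lt] at hcon
    have h1 : (n : ℝ)⁻¹ * ∑ i ∈ Finset.range n, V i ω ≤ Tbar ω := by
      simp only [hTbar]
      rw [mul_left_comm C, Finset.mul_sum _ _ C]
      exact mul_le_mul_of_nonneg_left
        (Finset.sum_le_sum fun i _ => (le_abs_self _).trans (hω i)) hninv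
    have h2 : (n : ℝ)⁻¹ * ∑ i ∈ Finset.range n, h (x i ω, y i ω) =
        Ubar ω + (n : ℝ)⁻¹ * ∑ i ∈ Finset.range n, V i ω := by
      rw [hUbar, ← mul_add, ← Finset.sum_add_distrib]
      simp only [hadd]
    linarith [hcon.1.2, hcon.2]
  obtain ⟨hmem, hvar⟩ := variance_average_le hUm hUind hUK n
  have hcheb : P.real {ω | d ≤ |Ubar ω - ∫ ω, Ubar ω ∂P|} ≤ (C * K) ^ 2 * (n : ℝ)⁻¹ / d ^ 2 := by
    refine ENNReal.toReal_le_of_le_ofReal (by positivity)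
      ((meas_ge_le_variance_div_sq hmem hd0).trans (ENNReal.ofReal_le_ofReal ?_))
    gcongr
  have hmarkov : P.real {ω | d ≤ Tbar ω} < ε / 2 := by
    have h1 := mul_meas_ge_le_integral_of_nonneg (μ := P) (f := Tbar)
      (.of_forall fun ω => mul_nonneg hC0
        (mul_nonneg hninv (Finset.sum_nonneg fun i _ => hT0 i ω)))
      (((integrable_finsetSum _ fun i _ => hTi i).const_mul _).const_mul _) d
    rw [hTbarInt] at h1
    exact lt_of_mul_lt_mul_left (h1.trans_lt hn1) hd0.le
  calc P.real {ω | a ≤ (n : ℝ)⁻¹ * ∑ i ∈ Finset.range n, h (x i ω, y i ω)}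
      ≤ P.real ({ω | d ≤ |Ubar ω - ∫ ω, Ubar ω ∂P|} ∪ {ω | d ≤ Tbar ω}) :=
        ENNReal.toReal_mono (measure_ne_top _ _) (measure_mono_ae hsub)
    _ ≤ P.real {ω | d ≤ |Ubar ω - ∫ ω, Ubar ω ∂P|} + P.real {ω | d ≤ Tbar ω} :=
        measureReal_union_le _ _
    _ < ε := by linarith

end WeakLaw

/-! ### Uniform negativity of random sums over a compact set -/

/-- If the averaged expectations of `f · β` have a negative limit for every `β` in a compact set,
then with probability tending to one all the sums `∑ f (x i, y i) β` are negative at once. -/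
theorem ConvergesWithEnvelope.tendsto_measure_exists_nonneg {Ω E F Θ : Type*} [MeasurableSpace Ω]
    {P : Measure Ω} [IsProbabilityMeasure P] [NormedAddCommGroup E] [MeasurableSpace E]
    [BorelSpace E] [ProperSpace E] [TopologicalSpace F] [SecondCountableTopology F]
    [MeasurableSpace F] [OpensMeasurableSpace F] [TopologicalSpace Θ] {x : ℕ → Ω → E}
    {ν : Measure E} {b : E → ℝ} (H : ConvergesWithEnvelope P x ν b) {y : ℕ → Ω → F}
    (hy : ∀ i, Measurable (y i)) (hindep : iIndepFun (fun i ω => (x i ω, y i ω)) P)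
    {Y : Set F} (hY : IsCompact Y) (hyY : ∀ i, ∀ᵐ ω ∂P, y i ω ∈ Y)
    {K : Set Θ} (hK : IsCompact K) {f : E × F → Θ → ℝ} (hf : Continuous fun q : (E × F) × Θ => f q.1 q.2)
    {C : ℝ} (hC0 : 0 ≤ C) (hC : ∀ z, ∀ u ∈ Y, ∀ β ∈ K, |f (z, u) β| ≤ C * b z) {m : Θ → ℝ}
    (hm : ∀ β ∈ K, Tendsto
      (fun n : ℕ => (n : ℝ)⁻¹ * ∑ i ∈ Finset.range n, ∫ ω, f (x i ω, y i ω) β ∂P) atTop (𝓝 (m β)))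
    (hneg : ∀ β ∈ K, m β < 0) :
    Tendsto (fun n : ℕ => P {ω | ∃ β ∈ K, 0 ≤ ∑ i ∈ Finset.range n, f (x i ω, y i ω) β})
      atTop (𝓝 0) := by
  refine hK.induction_on (p := fun s => Tendsto
    (fun n : ℕ => P {ω | ∃ β ∈ s, 0 ≤ ∑ i ∈ Finset.range n, f (x i ω, y i ω) β}) atTop (𝓝 0))
    (by simp) (fun s t hst ht => ?_) (fun s t hs ht => ?_) (fun β hβ => ?_)
  · refine tendsto_of_tendsto_of_tendsto_of_le_of_le tendsto_const_nhds ht (fun _ => zero_le)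
      fun n => measure_mono ?_
    rintro ω ⟨β, hβ, h⟩
    exact ⟨β, hst hβ, h⟩
  · have hadd := hs.add ht
    rw [add_zero] at hadd
    refine tendsto_of_tendsto_of_tendsto_of_le_of_le tendsto_const_nhds hadd (fun _ => zero_le)
      fun n => (measure_mono ?_).trans (measure_union_le _ _)
    rintro ω ⟨β, hβ | hβ, h⟩
    · exact .inl ⟨β, hβ, h⟩
    · exact .inr ⟨β, hβ, h⟩
  set δ := -m β / 4 with hδ
  have hδ0 : 0 < δ := by linarith [hneg β hβ]
  have htail : Tendsto (fun M => 2 * C * ∫ z, b z * tailCutoff M z ∂ν) atTop (𝓝 (2 * C * 0)) :=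
    H.tendsto_integral_tail.const_mul _
  rw [mul_zero] at htail
  obtain ⟨M, hM⟩ := (htail.eventually (gt_mem_nhds hδ0)).exists
  have hfβ (β : Θ) : Continuous fun q => f q β := hf.comp (by fun_prop : Continuous fun q => (q, β))
  have hnear : ∀ᶠ β' in 𝓝 β, ∀ q ∈ Metric.closedBall (0 : E) (M + 1) ×ˢ Y, f q β' < f q β + δ := by
    refine ((isCompact_closedBall _ _).prod hY).eventually_forall_of_forall_eventually fun q _ => ?_
    have hl : Continuous fun r : Θ × (E × F) => f r.2 r.1 :=
      hf.comp (by fun_prop : Continuous fun r : Θ × (E × F) => (r.2, r.1))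
    have hr : Continuous fun r : Θ × (E × F) => f r.2 β + δ :=
      ((hfβ β).comp continuous_snd).add_const δ
    exact hl.continuousAt.eventually_lt hr.continuousAt (by simpa using hδ0)
  refine ⟨{β' | ∀ q ∈ Metric.closedBall (0 : E) (M + 1) ×ˢ Y, f q β' < f q β + δ} ∩ K,
    inter_mem (mem_nhdsWithin_of_mem_nhds hnear) self_mem_nhdsWithin, ?_⟩
  set h : E × F → ℝ := fun q => f q β + 2 * C * (b q.1 * tailCutoff M q.1) with hh
  have htail0 (z : E) : 0 ≤ b z * tailCutoff M z := mul_nonneg (H.nonneg z) (tailCutoff_nonneg M z)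
  have hbound (z : E) (u : F) (hu : u ∈ Y) (β' : Θ)
      (hβ' : ∀ q ∈ Metric.closedBall (0 : E) (M + 1) ×ˢ Y, f q β' < f q β + δ) (hβK : β' ∈ K) :
      f (z, u) β' ≤ h (z, u) + δ := by
    have h0 := mul_nonneg hC0 (htail0 z)
    simp only [hh]
    rcases le_total ‖z‖ (M + 1) with hz | hz
    · have := hβ' (z, u) ⟨by simpa using hz, hu⟩
      linarith
    · rw [tailCutoff_of_le_norm hz, mul_one]
      have h1 := (abs_le.1 (hC z u hu β' hβK)).2
      have h2 := (abs_le.1 (hC z u hu β hβ)).1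
      linarith
  have hxy (i : ℕ) : Measurable fun ω => (x i ω, y i ω) := (H.measurable i).prodMk (hy i)
  have hfi (i : ℕ) : Integrable (fun ω => f (x i ω, y i ω) β) P := by
    refine ((H.integrable_comp i).const_mul C).mono'
      ((hfβ β).measurable.comp (hxy i)).aestronglyMeasurable ?_
    filter_upwards [hyY i] with ω hω using hC _ _ hω β hβ
  have hTi (i : ℕ) : Integrable (fun ω => b (x i ω) * tailCutoff M (x i ω)) P :=
    H.integrable_comp_of_le (H.continuous_tail M) (H.abs_tail_le M) i
  have hlim : Tendsto (fun n : ℕ => (n : ℝ)⁻¹ * ∑ i ∈ Finset.range n, ∫ ω, h (x i ω, y i ω) ∂P)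
      atTop (𝓝 (m β + 2 * C * ∫ z, b z * tailCutoff M z ∂ν)) := by
    refine ((hm β hβ).add ((H.tendsto_average_tail M).const_mul (2 * C))).congr fun n => ?_
    rw [average, mul_left_comm (2 * C), ← mul_add, Finset.mul_sum _ _ (2 * C),
      ← Finset.sum_add_distrib]
    congr 1
    refine Finset.sum_congr rfl fun i _ => ?_
    rw [← integral_const_mul, ← integral_add (hfi i) ((hTi i).const_mul _)]
  have hdom (i : ℕ) : ∀ᵐ ω ∂P, |h (x i ω, y i ω)| ≤ 3 * C * b (x i ω) := by
    filter_upwards [hyY i] with ω hω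
    have h1 := hC (x i ω) _ hω β hβ
    have h2 := mul_le_mul_of_nonneg_left (H.abs_tail_le M (x i ω)) hC0
    rw [abs_of_nonneg (htail0 _)] at h2
    refine (abs_add_le _ _).trans ?_
    rw [abs_of_nonneg (mul_nonneg (by linarith) (htail0 _))]
    linarith
  have hmeas : Measurable h :=
    (hfβ β).measurable.add ((((H.continuous_tail M).measurable).comp measurable_fst).const_mul _)
  have hlaw := H.weak_law hy hindep hmeas (by positivity) hdom hlim
    (a := m β + 2 * δ) (by linarith)
  refine tendsto_of_tendsto_of_tendsto_of_le_of_le' tendsto_const_nhds hlaw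
    (.of_forall fun _ => zero_le) ?_
  filter_upwards [eventually_gt_atTop 0] with n hn
  refine measure_mono_ae ?_
  filter_upwards [ae_all_iff.2 hyY] with ω hω hmem
  obtain ⟨β', ⟨hβ', hβK⟩, hge⟩ := hmem
  have hn' : (0 : ℝ) < n := by exact_mod_cast hn
  have hle : ∑ i ∈ Finset.range n, f (x i ω, y i ω) β' ≤
      ∑ i ∈ Finset.range n, h (x i ω, y i ω) + n * δ := by
    refine (Finset.sum_le_sum fun i _ => hbound _ _ (hω i) β' hβ' hβK).trans_eq ?_
    rw [Finset.sum_add_distrib]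
    simp
  change m β + 2 * δ ≤ (n : ℝ)⁻¹ * ∑ i ∈ Finset.range n, h (x i ω, y i ω)
  rw [le_inv_mul_iff₀ hn']
  nlinarith

/-! ### The score along the direction of the error -/

section Ascent

variable {p : ℕ} {g : ℝ → ℝ}

/-- The contribution of the observation `q = (x, y)` to the inner product of the score at `β` (up to
the factor `l`) with `β - β₀`. -/
def ascent (g : ℝ → ℝ) (β₀ : Vec p) (q : Vec p × ℝ) (β : Vec p) : ℝ :=
  (q.2 - invLink g (linPred q.1 β)) * weight g (linPred q.1 β) * linPred q.1 (β - β₀)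

/-- The conditional mean of `ascent` given the covariates. -/
def drift (g : ℝ → ℝ) (β₀ β z : Vec p) : ℝ := ascent g β₀ (z, invLink g (linPred z β₀)) β

lemma IsLink.continuous_ascent (hg : IsLink g) (β₀ : Vec p) :
    Continuous fun q : (Vec p × ℝ) × Vec p => ascent g β₀ q.1 q.2 := by
  have h1 : Continuous fun q : (Vec p × ℝ) × Vec p => linPred q.1.1 q.2 :=
    continuous_linPred.comp (by fun_prop : Continuous fun q : (Vec p × ℝ) × Vec p => (q.1.1, q.2))
  have h2 : Continuous fun q : (Vec p × ℝ) × Vec p => linPred q.1.1 (q.2 - β₀) :=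
    continuous_linPred.comp
      (by fun_prop : Continuous fun q : (Vec p × ℝ) × Vec p => (q.1.1, q.2 - β₀))
  exact (((continuous_snd.comp continuous_fst).sub (hg.continuous_invLink.comp h1)).mul
    (hg.continuous_weight.comp h1)).mul h2

lemma IsLink.continuous_drift (hg : IsLink g) (β₀ β : Vec p) : Continuous (drift g β₀ β) := by
  have h : Continuous fun z : Vec p => invLink g (linPred z β₀) :=
    hg.continuous_invLink.comp
      (continuous_linPred.comp (by fun_prop : Continuous fun z : Vec p => (z, β₀)))
  exact (hg.continuous_ascent β₀).comp ((continuous_id.prodMk h).prodMk continuous_const)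

lemma IsLink.abs_ascent_le (hg : IsLink g) {β₀ β z : Vec p} {u c D : ℝ} (hu : u ∈ Icc (0 : ℝ) 1)
    (hc : ‖z‖ * |weight g (linPred z β)| ≤ c) (hD : ‖β - β₀‖ ≤ D) :
    |ascent g β₀ (z, u) β| ≤ D * c := by
  have hμ := hg.invLink_mem (linPred z β)
  have h1 : |u - invLink g (linPred z β)| ≤ 1 :=
    abs_le.2 ⟨by linarith [hu.1, hμ.2], by linarith [hu.2, hμ.1]⟩
  have h2 : |linPred z (β - β₀)| ≤ ‖z‖ * ‖β - β₀‖ := by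
    rw [linPred_eq_inner]
    exact abs_real_inner_le_norm _ _
  rw [ascent, abs_mul, abs_mul]
  calc |u - invLink g (linPred z β)| * |weight g (linPred z β)| * |linPred z (β - β₀)|
      ≤ 1 * |weight g (linPred z β)| * (‖z‖ * ‖β - β₀‖) := by gcongr
    _ = ‖β - β₀‖ * (‖z‖ * |weight g (linPred z β)|) := by ring
    _ ≤ D * c := mul_le_mul hD hc (by positivity) ((norm_nonneg _).trans hD)

lemma linPred_sub (z β β' : Vec p) : linPred z (β - β') = linPred z β - linPred z β' := by
  simp only [linPred_eq_inner, inner_sub_right]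

lemma IsLink.drift_neg (hg : IsLink g) {β₀ β z : Vec p} (h : linPred z β ≠ linPred z β₀) :
    drift g β₀ β z < 0 := by
  rw [drift, ascent, linPred_sub]
  exact hg.sub_mul_weight_mul_sub_neg h.symm

lemma IsLink.drift_nonpos (hg : IsLink g) (β₀ β z : Vec p) : drift g β₀ β z ≤ 0 := by
  by_cases h : linPred z β = linPred z β₀
  · simp [drift, ascent, h]
  · exact (hg.drift_neg h).le

lemma IsLink.integral_drift_neg (hg : IsLink g) {β₀ β : Vec p} {ν : Measure (Vec p)}
    (hint : Integrable (drift g β₀ β) ν)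
    (hne : ¬∀ᵐ z ∂ν, invLink g (linPred z β) = invLink g (linPred z β₀)) :
    ∫ z, drift g β₀ β z ∂ν < 0 := by
  refine lt_of_le_of_ne (integral_nonpos (hg.drift_nonpos β₀ β)) fun h0 => hne ?_
  have h1 : ∫ z, -drift g β₀ β z ∂ν = 0 := by rw [integral_neg, h0, neg_zero]
  have h2 := (integral_eq_zero_iff_of_nonneg
    (fun z => neg_nonneg.2 (hg.drift_nonpos β₀ β z)) hint.neg).1 h1
  filter_upwards [h2] with z hz
  by_contra h
  exact (hg.drift_neg fun h' => h (by rw [h'])).ne (neg_eq_zero.1 hz)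

/-- The conditional mean of the ascent direction, integrated. -/
lemma IsLink.integral_ascent (hg : IsLink g) {Ω : Type*} [MeasurableSpace Ω] {P : Measure Ω}
    [IsProbabilityMeasure P] {x : Ω → Vec p} {y : Ω → ℝ} (hx : Measurable x) (hy : Measurable y)
    (hy01 : ∀ᵐ ω ∂P, y ω ∈ Icc (0 : ℝ) 1) {β₀ β : Vec p}
    (hmean : P[y | MeasurableSpace.comap x inferInstance]
      =ᵐ[P] fun ω => invLink g (linPred (x ω) β₀))
    {c : Vec p → ℝ} (hc : ∀ z, ‖z‖ * |weight g (linPred z β)| ≤ c z)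
    (hci : Integrable (fun ω => c (x ω)) P) :
    ∫ ω, ascent g β₀ (x ω, y ω) β ∂P = ∫ ω, drift g β₀ β (x ω) ∂P := by
  set A : Vec p → ℝ := fun z => weight g (linPred z β) * linPred z (β - β₀) with hA
  have hlin (v : Vec p) : Continuous fun z : Vec p => linPred z v :=
    continuous_linPred.comp (by fun_prop : Continuous fun z : Vec p => (z, v))
  have hAc : Continuous A := (hg.continuous_weight.comp (hlin β)).mul (hlin (β - β₀))
  have hAm : StronglyMeasurable[MeasurableSpace.comap x inferInstance] fun ω => A (x ω) :=
    (hAc.measurable.comp (comap_measurable x)).stronglyMeasurable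
  have hmul {u : Ω → ℝ} (hu : Measurable u) (hu01 : ∀ᵐ ω ∂P, u ω ∈ Icc (0 : ℝ) 1) :
      Integrable (fun ω => A (x ω) * u ω) P := by
    refine (hci.const_mul ‖β - β₀‖).mono'
      ((hAc.measurable.comp hx).mul hu).aestronglyMeasurable ?_
    filter_upwards [hu01] with ω hω
    have h2 : |linPred (x ω) (β - β₀)| ≤ ‖x ω‖ * ‖β - β₀‖ := by
      rw [linPred_eq_inner]
      exact abs_real_inner_le_norm _ _
    have h3 : |u ω| ≤ 1 := abs_le.2 ⟨by linarith [hω.1], hω.2⟩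
    rw [Real.norm_eq_abs, abs_mul, hA, abs_mul]
    calc |weight g (linPred (x ω) β)| * |linPred (x ω) (β - β₀)| * |u ω|
        ≤ |weight g (linPred (x ω) β)| * (‖x ω‖ * ‖β - β₀‖) * 1 := by gcongr
      _ = ‖β - β₀‖ * (‖x ω‖ * |weight g (linPred (x ω) β)|) := by ring
      _ ≤ ‖β - β₀‖ * c (x ω) := by gcongr; exact hc _
  have hμi (v : Vec p) : Integrable (fun ω => A (x ω) * invLink g (linPred (x ω) v)) P :=
    hmul ((hg.continuous_invLink.comp (hlin v)).measurable.comp hx)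
      (.of_forall fun ω => Ioo_subset_Icc_self (hg.invLink_mem _))
  have hyi : Integrable y P := by
    refine (integrable_const (1 : ℝ)).mono' hy.aestronglyMeasurable ?_
    filter_upwards [hy01] with ω hω
    exact abs_le.2 ⟨by linarith [hω.1], hω.2⟩
  have hcond : ∫ ω, A (x ω) * y ω ∂P = ∫ ω, A (x ω) * invLink g (linPred (x ω) β₀) ∂P := by
    have hpull := condExp_mul_of_stronglyMeasurable_left (μ := P) hAm (hmul hy hy01) hyi
    rw [← integral_condExp hx.comap_le]
    refine integral_congr_ae (hpull.trans ?_)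
    filter_upwards [hmean] with ω hω
    simp [hω]
  have h1 (ω : Ω) : ascent g β₀ (x ω, y ω) β =
      A (x ω) * y ω - A (x ω) * invLink g (linPred (x ω) β) := by
    simp only [ascent, hA]; ring
  have h2 (ω : Ω) : drift g β₀ β (x ω) =
      A (x ω) * invLink g (linPred (x ω) β₀) - A (x ω) * invLink g (linPred (x ω) β) := by
    simp only [drift, ascent, hA]; ring
  simp only [h1, h2]
  rw [integral_sub (hmul hy hy01) (hμi β), integral_sub (hμi β₀) (hμi β), hcond]

/-- At a solution of the likelihood equations the score is orthogonal to the error. -/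
lemma SolvesLikelihoodEq.sum_ascent_eq_zero {l n : ℕ} (hl : 1 ≤ l) {x : ℕ → Vec p} {y : ℕ → ℝ}
    {β : Vec p} (h : SolvesLikelihoodEq g l n x y β) (β₀ : Vec p) :
    ∑ i ∈ Finset.range n, ascent g β₀ (x i, y i) β = 0 := by
  have hl' : (l : ℝ) ≠ 0 := by positivity
  have h1 (j : Fin p) : ∑ i ∈ Finset.range n,
      (y i - invLink g (linPred (x i) β)) * weight g (linPred (x i) β) * x i j = 0 := by
    have := h j
    rw [score_eq_sum_weight] at this
    exact (mul_eq_zero.1 this).resolve_left hl'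
  simp only [ascent, linPred, Finset.mul_sum]
  rw [Finset.sum_comm]
  refine Finset.sum_eq_zero fun j _ => ?_
  simp only [← mul_assoc, ← Finset.sum_mul]
  exact mul_eq_zero_of_left (h1 j) _

/-- If the score points towards `β₀` on a sphere about `β₀`, then the likelihood equations have a
solution in the ball. -/
lemma IsLink.exists_solvesLikelihoodEq (hg : IsLink g) {l n : ℕ} (hl : 1 ≤ l) {x : ℕ → Vec p}
    {y : ℕ → ℝ} {β₀ : Vec p} {r : ℝ} (hr : 0 < r)
    (hneg : ∀ β, ‖β - β₀‖ = r → ∑ i ∈ Finset.range n, ascent g β₀ (x i, y i) β < 0) :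
    ∃ β ∈ Metric.closedBall β₀ r, SolvesLikelihoodEq g l n x y β := by
  have hl' : (0 : ℝ) < l := by positivity
  obtain ⟨β, hβ, hmax⟩ := (isCompact_closedBall β₀ r).exists_isMaxOn
    ⟨β₀, Metric.mem_closedBall_self hr.le⟩ (hg.continuous_potential l n x y).continuousOn
  refine ⟨β, hβ, fun j => ?_⟩
  have hβr : ‖β - β₀‖ < r := by
    refine lt_of_le_of_ne (by simpa [dist_eq_norm] using hβ) fun heq => ?_
    have hd := hg.hasDerivAt_potential l n x y β (β₀ - β)
    have hpos : 0 < (l : ℝ) * ∑ i ∈ Finset.range n, (y i - invLink g (linPred (x i) β)) *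
        weight g (linPred (x i) β) * linPred (x i) (β₀ - β) := by
      have h0 := hneg β heq
      simp only [ascent] at h0
      have : ∀ i, linPred (x i) (β₀ - β) = -linPred (x i) (β - β₀) := fun i => by
        rw [linPred_sub, linPred_sub]; ring
      simp only [this, mul_neg, Finset.sum_neg_distrib]
      nlinarith
    have hev := (hd.tendsto_slope_zero_right).eventually (lt_mem_nhds hpos)
    have hle : ∀ᶠ t : ℝ in 𝓝[>] 0, t ≤ 1 := mem_nhdsWithin_of_mem_nhds (Iic_mem_nhds one_pos)
    obtain ⟨t, ⟨ht1, ht2⟩, ht0⟩ := ((hev.and hle).and self_mem_nhdsWithin).exists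
    have ht0' : 0 < t := ht0
    have hmem : β + t • (β₀ - β) ∈ Metric.closedBall β₀ r :=
      (convex_closedBall β₀ r).add_smul_sub_mem hβ (Metric.mem_closedBall_self hr.le)
        ⟨ht0'.le, ht2⟩
    have h1 : potential g l n x y (β + t • (β₀ - β)) ≤ potential g l n x y β := hmax hmem
    simp only [zero_add, zero_smul, add_zero, smul_eq_mul] at ht1
    exact absurd ht1 (not_lt.2 (mul_nonpos_of_nonneg_of_nonpos (by positivity) (by linarith)))
  have hloc : IsLocalMax (potential g l n x y) β :=
    hmax.isLocalMax (mem_of_superset (Metric.isOpen_ball.mem_nhds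
      (by simpa [dist_eq_norm] using hβr)) Metric.ball_subset_closedBall)
  have hline : Tendsto (fun t : ℝ => β + t • EuclideanSpace.single j (1 : ℝ)) (𝓝 0) (𝓝 β) := by
    have : Continuous fun t : ℝ => β + t • EuclideanSpace.single j (1 : ℝ) := by fun_prop
    simpa using this.tendsto 0
  have hloc' : IsLocalMax (fun t : ℝ => potential g l n x y
      (β + t • EuclideanSpace.single j 1)) 0 := by
    have := hline.eventually hloc
    simpa [IsLocalMax, IsMaxFilter] using this
  exact hloc'.hasDerivAt_eq_zero (hg.hasDerivAt_potential_single l n x y β j)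

end Ascent

end Cobin

end

theorem proposition1 {Ω : Type*} [MeasurableSpace Ω] (P : Measure Ω) [IsProbabilityMeasure P]
    {p : ℕ} (l : ℕ) (hl : 1 ≤ l) (g : ℝ → ℝ) (hg : Cobin.IsLink g)
    -- the observations: independent pairs of covariates and responses in `[0,1]`
    (x : ℕ → Ω → Cobin.Vec p) (y : ℕ → Ω → ℝ)
    (hx : ∀ i, Measurable (x i)) (hy : ∀ i, Measurable (y i))
    (hy01 : ∀ i, ∀ᵐ ω ∂P, y i ω ∈ Icc (0 : ℝ) 1)
    (hindep : iIndepFun (fun i ω => (x i ω, y i ω)) P)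
    -- compact parameter space with the true parameter in its interior
    (Θ : Set (Cobin.Vec p)) (hΘ : IsCompact Θ) (β₀ : Cobin.Vec p) (hβ₀ : β₀ ∈ interior Θ)
    -- the mean model is correctly specified (nothing else is assumed on the law of `y` given `x`)
    (hmean : ∀ i, P[y i | MeasurableSpace.comap (x i) inferInstance]
      =ᵐ[P] fun ω => Cobin.invLink g (Cobin.linPred (x i ω) β₀))
    -- the average law of the covariates converges weakly to some `ν`
    (ν : Measure (Cobin.Vec p)) [IsProbabilityMeasure ν]
    (hν : ∀ f : BoundedContinuousFunction (Cobin.Vec p) ℝ,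
      Tendsto (fun n : ℕ => (n : ℝ)⁻¹ * ∑ i ∈ Finset.range n, ∫ ω, f (x i ω) ∂P) atTop
        (𝓝 (∫ z, f z ∂ν)))
    -- domination of the score by a continuous function whose averages converge
    (b : Cobin.Vec p → ℝ) (hb : Continuous b)
    (hdom : ∀ z, ∀ β ∈ Θ,
      ‖z‖ * |deriv (Cobin.invLink g) (Cobin.linPred z β) /
        Cobin.B'' (Cobin.thetaOf g (Cobin.linPred z β))| ≤ b z)
    (hbν : Integrable b ν) (hbx : ∀ i, Integrable (fun ω => b (x i ω)) P)
    (hblim : Tendsto (fun n : ℕ => (n : ℝ)⁻¹ * ∑ i ∈ Finset.range n, ∫ ω, b (x i ω) ∂P) atTop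
      (𝓝 (∫ z, b z ∂ν)))
    -- identifiability of the parameter from the mean model
    (hident : ∀ β ∈ Θ,
      (∀ᵐ z ∂ν, Cobin.invLink g (Cobin.linPred z β) = Cobin.invLink g (Cobin.linPred z β₀)) →
        β = β₀) :
    -- the score consists of the partial derivatives of the cobin log-likelihood
    (∀ (n : ℕ) (xs : ℕ → Cobin.Vec p) (ys : ℕ → ℝ),
      (∀ i ∈ Finset.range n, ys i ∈ Cobin.support l) → ∀ (β : Cobin.Vec p) (j : Fin p),
        HasDerivAt (fun t : ℝ => Cobin.logLik g l n xs ys (β + t • EuclideanSpace.single j 1))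
          (Cobin.score g l n xs ys β j) 0) ∧
    -- with probability tending to one the likelihood equations have a solution
    Tendsto (fun n : ℕ => P {ω | ¬ ∃ β ∈ Θ,
      Cobin.SolvesLikelihoodEq g l n (fun i => x i ω) (fun i => y i ω) β}) atTop (𝓝 0) ∧
    -- every sequence of solutions is consistent
    (∀ βhat : ℕ → Ω → Cobin.Vec p,
      Tendsto (fun n : ℕ => P {ω | ¬ (βhat n ω ∈ Θ ∧
        Cobin.SolvesLikelihoodEq g l n (fun i => x i ω) (fun i => y i ω) (βhat n ω))})
          atTop (𝓝 0) →
      TendstoInMeasure P βhat atTop (fun _ => β₀)) := by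
  have hbnn (z : Cobin.Vec p) : 0 ≤ b z :=
    (by positivity : (0 : ℝ) ≤ _).trans (hdom z β₀ (interior_subset hβ₀))
  have H : Cobin.ConvergesWithEnvelope P x ν b := ⟨hx, hν, hb, hbnn, hbν, hbx, hblim⟩
  obtain ⟨D, hD0, hD⟩ : ∃ D, 0 ≤ D ∧ ∀ β ∈ Θ, ‖β - β₀‖ ≤ D := by
    obtain ⟨D, hD⟩ := hΘ.exists_bound_of_continuousOn
      (f := fun β => β - β₀) (by fun_prop)
    exact ⟨max D 0, le_max_right _ _, fun β hβ => (hD β hβ).trans (le_max_left _ _)⟩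
  have hdrift (β : Cobin.Vec p) (hβ : β ∈ Θ) (z : Cobin.Vec p) :
      |Cobin.drift g β₀ β z| ≤ D * b z :=
    hg.abs_ascent_le (Ioo_subset_Icc_self (hg.invLink_mem _)) (hdom z β hβ) (hD β hβ)
  have hsep (r : ℝ) (hr : 0 < r) : Tendsto (fun n : ℕ => P {ω | ∃ β ∈ Θ ∩ {β | r ≤ ‖β - β₀‖},
      0 ≤ ∑ i ∈ Finset.range n, Cobin.ascent g β₀ (x i ω, y i ω) β}) atTop (𝓝 0) := by
    refine H.tendsto_measure_exists_nonneg hy hindep isCompact_Icc hy01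
      (hΘ.inter_right (isClosed_le continuous_const (by fun_prop))) (hg.continuous_ascent β₀) hD0
      (fun z u hu β hβ => hg.abs_ascent_le hu (hdom z β hβ.1) (hD β hβ.1))
      (m := fun β => ∫ z, Cobin.drift g β₀ β z ∂ν) (fun β hβ => ?_) (fun β hβ => ?_)
    · refine (H.tendsto_average (hg.continuous_drift β₀ β) (hdrift β hβ.1)).congr fun n => ?_
      rw [Cobin.average]
      congr 1
      exact Finset.sum_congr rfl fun i _ => (hg.integral_ascent (hx i) (hy i) (hy01 i) (hmean i)
        (fun z => hdom z β hβ.1) (hbx i)).symm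
    · refine hg.integral_drift_neg
        (H.integrable_of_le (hg.continuous_drift β₀ β) (hdrift β hβ.1)) fun hae => ?_
      have hβr : r ≤ ‖β - β₀‖ := hβ.2
      rw [hident β hβ.1 hae, sub_self, norm_zero] at hβr
      exact hr.not_ge hβr
  refine ⟨fun n xs ys hys β j => hg.hasDerivAt_logLik hl xs hys β j, ?_, fun βhat hβhat => ?_⟩
  · obtain ⟨r, hr, hball⟩ := Metric.nhds_basis_closedBall.mem_iff.1 (mem_interior_iff_mem_nhds.1 hβ₀)
    refine tendsto_of_tendsto_of_tendsto_of_le_of_le tendsto_const_nhds (hsep r hr)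
      (fun _ => zero_le) fun n => measure_mono fun ω hω => ?_
    by_contra hcon
    refine hω ?_
    obtain ⟨β, hβ, hsol⟩ := hg.exists_solvesLikelihoodEq (n := n) hl hr
      (x := fun i => x i ω) (y := fun i => y i ω) fun β hβ => by
        by_contra hge
        exact hcon ⟨β, ⟨hball (by simp [dist_eq_norm, hβ]), hβ.ge⟩, not_lt.1 hge⟩
    exact ⟨β, hball hβ, hsol⟩
  · rw [tendstoInMeasure_iff_norm]
    intro r hr
    have hadd := hβhat.add (hsep r hr)
    rw [add_zero] at hadd
    refine tendsto_of_tendsto_of_tendsto_of_le_of_le tendsto_const_nhds hadd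
      (fun _ => zero_le) fun n => (measure_mono fun ω hω => ?_).trans (measure_union_le _ _)
    by_cases hcon : βhat n ω ∈ Θ ∧
        Cobin.SolvesLikelihoodEq g l n (fun i => x i ω) (fun i => y i ω) (βhat n ω)
    · exact .inr ⟨βhat n ω, ⟨hcon.1, hω⟩, (hcon.2.sum_ascent_eq_zero hl β₀).ge⟩
    · exact .inl hcon
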